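/- Let $\alpha>0$ be a real number that is not an integer, and let $\{c_k\}_{k=1}^\infty$ be a sequence of real numbers for which there are constants $A,B>0$ such that $$c_k\le A\,c_l\quad\text{for all integers } k\ge l\ge 1,\qquad\text{and}\qquad \sum_{k=l}^{2l-1}|c_k-c_{k+1}|\le B\,c_l\quad\text{for all integers } l\ge1.$$ Then the series $\sum_{k=1}^\infty c_k\sin(k^\alpha x)$ converges uniformly in $x$ on every bounded subset of $\mathbb R$ if and only if $k\,c_k\to0$ as $k\to\infty$. -/

import Mathlib

/-- The partial sum `∑_{k=1}^{N} c_k sin(k^α x)`. The value `c 0` is never used. -/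
noncomputable def sinePartialSum (α : ℝ) (c : ℕ → ℝ) (N : ℕ) (x : ℝ) : ℝ :=
  ∑ k ∈ Finset.Icc 1 N, c k * Real.sin ((k : ℝ) ^ α * x)

/-- The series `∑_{k ≥ 1} c_k sin(k^α x)` converges uniformly on `S`: its partial sums converge
uniformly on `S` to some real function. -/
def SineSeriesConvergesUniformlyOn (α : ℝ) (c : ℕ → ℝ) (S : Set ℝ) : Prop :=
  ∃ f : ℝ → ℝ, TendstoUniformlyOn (sinePartialSum α c) f Filter.atTop S

/-- `c_k ≤ A c_l` for all `k ≥ l ≥ 1`, with a constant `A > 0`. -/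
def IsQuasiNonincreasing (c : ℕ → ℝ) : Prop :=
  ∃ A : ℝ, 0 < A ∧ ∀ l k : ℕ, 1 ≤ l → l ≤ k → c k ≤ A * c l

/-- `∑_{k=l}^{2l-1} |c_k - c_{k+1}| ≤ B c_l` for all `l ≥ 1`, with a constant `B > 0`
(general monotone sequences). -/
def IsGeneralMonotone (c : ℕ → ℝ) : Prop :=
  ∃ B : ℝ, 0 < B ∧ ∀ l : ℕ, 1 ≤ l →
    ∑ k ∈ Finset.Ico l (2 * l), |c k - c (k + 1)| ≤ B * c l

/-! Sufficiency is proved through the uniform Cauchy criterion. On a piece of a dyadic block `[l,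
2l]` starting at `a`, Abel summation and the two conditions on `c` bound the sum by a constant times
`c a` times the largest partial sum of `sin (k ^ α * x)`. If `k * c k ≤ ε` far out, it remains to
show that these sine sums, divided by `l`, have a total over `l = 2 ^ i` bounded uniformly in `0 < x
≤ R`.

Put `y j = x * l ^ (α - j)`, roughly the size of the `j`-th differences of the phase. Van der
Corput's method saves a factor `y (j+1) ^ σ + y j ^ (-σ)` for each `j < α`. As `y` decreases in `j`,
either `y 0 < 1` and `|sin u| ≤ |u|` suffices, or one uses the index where `y` crosses 1, or,
without a crossing, the last index and `x ≤ R`. With `m = ⌈α⌉` the saving is at most a constant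
times the sum over `j < m` of `min (y j ^ σ) (y j ^ (-σ))` plus `(R * l ^ (α - m)) ^ σ`. Along `l =
2 ^ i` each `y j` with `j < m` grows geometrically, so its minima sum to a bound free of `x`; the
last term decays geometrically because `α < m`, which is where non-integrality enters.

For necessity, at `x = (π / 2) * (2n) ^ (-α)` every sine with `n < k ≤ 2n` is at least `2 ^ (-α)`,
so the Cauchy criterion forces `n * c (2n) → 0`. -/

/-! ### Van der Corput's inequality -/

open Finset Complex in
theorem sq_norm_sum_le_of_shifted_correlations (z : ℕ → ℂ) (hz : ∀ n, ‖z n‖ ≤ 1) (N H : ℕ)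
    (hH : 1 ≤ H) (D : ℝ) (hD0 : 0 ≤ D)
    (hD : ∀ h, 1 ≤ h → h < H →
      ‖∑ n ∈ range (N - h), z (n + h) * (starRingEnd ℂ) (z n)‖ ≤ D) :
    (H : ℝ) * ‖∑ n ∈ range N, z n‖ ^ 2 ≤ (N + H) * (N + H * D) := by
  -- Column `k` is `z`, cut off to `[0, N)` and shifted by `k`. All `H` columns have the same sum,
  -- and products of two columns give the shifted correlations. Cauchy–Schwarz over the `N + H` rows
  -- then gives the bound.
  set u : ℕ → ℕ → ℂ := fun m k => if m ∈ Ico k (k + N) then z (m - k) else 0 with hu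
  have hcol : ∀ k ∈ range H, ∑ m ∈ range (N + H), u m k = ∑ n ∈ range N, z n := by
    intro k hk
    have hk' := mem_range.1 hk
    have hsub : Ico k (k + N) ⊆ range (N + H) := by
      intro m hm
      simp only [mem_Ico, mem_range] at *
      omega
    rw [← sum_subset hsub (fun m _ hm => by simp only [hu]; rw [if_neg hm]),
      sum_Ico_eq_sum_range, Nat.add_sub_cancel_left]
    refine sum_congr rfl fun n hn => ?_
    have hn' := mem_range.1 hn
    have : k + n ∈ Ico k (k + N) := by simp only [mem_Ico]; omega
    simp only [hu]
    rw [if_pos this, Nat.add_sub_cancel_left]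
  have hcorr : ∀ k k', k ≤ k' → k' < H →
      ∑ m ∈ range (N + H), u m k * (starRingEnd ℂ) (u m k') =
        ∑ n ∈ range (N - (k' - k)), z (n + (k' - k)) * (starRingEnd ℂ) (z n) := by
    intro k k' hkk hk'
    have hsub : Ico k' (k + N) ⊆ range (N + H) := by
      intro m hm
      simp only [mem_Ico, mem_range] at *
      omega
    have hzero : ∀ m ∈ range (N + H), m ∉ Ico k' (k + N) →
        u m k * (starRingEnd ℂ) (u m k') = 0 := by
      intro m _ hm
      simp only [mem_Ico] at hm
      by_cases h1 : m < k'
      · have : m ∉ Ico k' (k' + N) := by simp only [mem_Ico]; omega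
        simp only [hu]
        rw [if_neg this, map_zero, mul_zero]
      · have : m ∉ Ico k (k + N) := by simp only [mem_Ico]; omega
        simp only [hu]
        rw [if_neg this, zero_mul]
    rw [← sum_subset hsub hzero, sum_Ico_eq_sum_range]
    have e1 : k + N - k' = N - (k' - k) := by omega
    rw [e1]
    refine sum_congr rfl fun n hn => ?_
    have hn' := mem_range.1 hn
    have h1 : k' + n ∈ Ico k (k + N) := by simp only [mem_Ico]; omega
    have h2 : k' + n ∈ Ico k' (k' + N) := by simp only [mem_Ico]; omega
    have e2 : k' + n - k = n + (k' - k) := by omega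
    simp only [hu]
    rw [if_pos h1, if_pos h2, e2, Nat.add_sub_cancel_left]
  have hdiag : ∀ k, k < H → ‖∑ m ∈ range (N + H), u m k * (starRingEnd ℂ) (u m k)‖ ≤ N := by
    intro k hk
    rw [hcorr k k le_rfl hk]
    refine (norm_sum_le _ _).trans ?_
    calc _ ≤ ∑ n ∈ range (N - (k - k)), (1 : ℝ) := by
          refine sum_le_sum fun n _ => ?_
          rw [norm_mul, RCLike.norm_conj]
          exact mul_le_one₀ (hz _) (norm_nonneg _) (hz _)
      _ = N := by simp
  have hoff : ∀ k k', k < H → k' < H →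
      ‖∑ m ∈ range (N + H), u m k * (starRingEnd ℂ) (u m k')‖ ≤
        (if k = k' then (N : ℝ) else 0) + D := by
    intro k k' hk hk'
    rcases lt_trichotomy k k' with h | h | h
    · rw [hcorr k k' h.le hk', if_neg h.ne, zero_add]
      exact hD _ (by omega) (by omega)
    · subst h
      rw [if_pos rfl]
      exact (hdiag k hk).trans (by linarith)
    · have : ∑ m ∈ range (N + H), u m k * (starRingEnd ℂ) (u m k') =
          (starRingEnd ℂ) (∑ m ∈ range (N + H), u m k' * (starRingEnd ℂ) (u m k)) := by
        rw [map_sum]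
        refine sum_congr rfl fun m _ => ?_
        rw [map_mul, Complex.conj_conj, mul_comm]
      rw [this, RCLike.norm_conj, hcorr k' k h.le hk, if_neg h.ne', zero_add]
      exact hD _ (by omega) (by omega)
  have hS : (H : ℂ) * ∑ n ∈ range N, z n = ∑ m ∈ range (N + H), ∑ k ∈ range H, u m k := by
    rw [sum_comm, sum_congr rfl hcol]
    simp
  have hsq : ((∑ m ∈ range (N + H), ‖∑ k ∈ range H, u m k‖ ^ 2 : ℝ) : ℂ) =
      ∑ k ∈ range H, ∑ k' ∈ range H, ∑ m ∈ range (N + H), u m k * (starRingEnd ℂ) (u m k') := by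
    rw [Complex.ofReal_sum]
    calc _ = ∑ m ∈ range (N + H), ∑ k ∈ range H, ∑ k' ∈ range H,
          u m k * (starRingEnd ℂ) (u m k') := by
          refine sum_congr rfl fun m _ => ?_
          rw [Complex.ofReal_pow, ← Complex.mul_conj', map_sum, sum_mul_sum]
      _ = _ := by
          rw [sum_comm]
          exact sum_congr rfl fun k _ => sum_comm
  have hbound : ∑ m ∈ range (N + H), ‖∑ k ∈ range H, u m k‖ ^ 2 ≤ H * (N + H * D) := by
    have h1 : ∑ m ∈ range (N + H), ‖∑ k ∈ range H, u m k‖ ^ 2 =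
        ‖((∑ m ∈ range (N + H), ‖∑ k ∈ range H, u m k‖ ^ 2 : ℝ) : ℂ)‖ := by
      rw [Complex.norm_real, Real.norm_of_nonneg (sum_nonneg fun _ _ => by positivity)]
    rw [h1, hsq]
    calc _ ≤ ∑ k ∈ range H, ∑ k' ∈ range H, ((if k = k' then (N : ℝ) else 0) + D) := by
          refine (norm_sum_le _ _).trans (sum_le_sum fun k hk => ?_)
          refine (norm_sum_le _ _).trans (sum_le_sum fun k' hk' => ?_)
          exact hoff k k' (mem_range.1 hk) (mem_range.1 hk')
      _ = ∑ k ∈ range H, ((N : ℝ) + H * D) := by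
          refine sum_congr rfl fun k hk => ?_
          rw [sum_add_distrib, sum_ite_eq, if_pos hk]
          simp
      _ = H * (N + H * D) := by rw [sum_const, card_range, nsmul_eq_mul]
  have hCS : ‖∑ m ∈ range (N + H), ∑ k ∈ range H, u m k‖ ^ 2 ≤
      (N + H) * ∑ m ∈ range (N + H), ‖∑ k ∈ range H, u m k‖ ^ 2 := by
    have h1 : (∑ m ∈ range (N + H), ‖∑ k ∈ range H, u m k‖) ^ 2 ≤
        (range (N + H)).card * ∑ m ∈ range (N + H), ‖∑ k ∈ range H, u m k‖ ^ 2 :=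
      sq_sum_le_card_mul_sum_sq
    rw [card_range, Nat.cast_add] at h1
    exact (pow_le_pow_left₀ (norm_nonneg _) (norm_sum_le _ _) 2).trans h1
  rw [← hS, norm_mul, mul_pow, Complex.norm_natCast] at hCS
  have hH0 : (0 : ℝ) < H := by exact_mod_cast hH
  have h2 : (H : ℝ) ^ 2 * ‖∑ n ∈ range N, z n‖ ^ 2 ≤ (N + H) * (H * (N + H * D)) :=
    hCS.trans (mul_le_mul_of_nonneg_left hbound (by positivity))
  have h3 : (H : ℝ) * (H * ‖∑ n ∈ range N, z n‖ ^ 2) ≤ H * ((N + H) * (N + H * D)) := by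
    linarith
  exact le_of_mul_le_mul_left h3 hH0

/-! ### Sums with small first differences (Kusmin–Landau) -/

open Finset Complex in
theorem half_le_norm_exp_I_mul_sub_one {d : ℝ} (h0 : 0 ≤ d) (h1 : d ≤ 1) :
    d / 2 ≤ ‖exp (I * d) - 1‖ := by
  rw [norm_exp_I_mul_ofReal_sub_one]
  have hpi := Real.pi_gt_three
  have hpi4 := Real.pi_le_four
  have h2 : 2 / Real.pi * (d / 2) ≤ Real.sin (d / 2) := Real.mul_le_sin (by linarith) (by linarith)
  have h3 : (1 : ℝ) / 2 ≤ 2 / Real.pi := by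
    rw [div_le_div_iff₀ (by norm_num) (by linarith)]
    linarith
  have h4 : 1 / 2 * (d / 2) ≤ 2 / Real.pi * (d / 2) :=
    mul_le_mul_of_nonneg_right h3 (by linarith)
  refine le_trans ?_ (le_abs_self _)
  linarith

open Complex in
theorem norm_exp_I_mul_sub_exp_I_mul_le (a b : ℝ) :
    ‖exp (I * a) - exp (I * b)‖ ≤ |a - b| := by
  have h : exp (I * a) - exp (I * b) = exp (I * b) * (exp (I * ((a - b : ℝ) : ℂ)) - 1) := by
    rw [mul_sub, ← Complex.exp_add, mul_one]
    congr 2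
    push_cast
    ring
  rw [h, norm_mul, mul_comm I (b : ℂ), Complex.norm_exp_ofReal_mul_I, one_mul]
  exact Real.norm_exp_I_mul_ofReal_sub_one_le

open Complex in
theorem norm_exp_I_mul_real (a : ℝ) : ‖exp (I * a)‖ = 1 := by
  rw [mul_comm, Complex.norm_exp_ofReal_mul_I]

open Finset Complex in
theorem norm_sum_exp_le_card (f : ℕ → ℝ) (N : ℕ) :
    ‖∑ n ∈ range N, exp (I * (f n : ℂ))‖ ≤ N := by
  refine (norm_sum_le _ _).trans ?_
  simp

-- Dividing by `exp (I * d n) - 1` writes each term as `w n` times a difference of consecutive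
-- terms. Summation by parts leaves boundary terms of size `2 / lam` and the variation of `w`, at
-- most `N * 4K / (lam * L)`.
open Finset Complex in
theorem norm_sum_exp_le_of_fwdDiff_small (f : ℕ → ℝ) (N : ℕ) (K L lam : ℝ) (hlam : 0 < lam)
    (hK : 1 ≤ K) (hL : 1 ≤ L) (hNL : (N : ℝ) ≤ L) (hKl : K * lam ≤ 1)
    (hf : ∀ n < N, lam ≤ f (n + 1) - f n ∧ f (n + 1) - f n ≤ K * lam ∧
      |(f (n + 2) - f (n + 1)) - (f (n + 1) - f n)| ≤ K * lam / L) :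
    ‖∑ n ∈ range N, exp (I * (f n : ℂ))‖ ≤ (4 + 4 * K) / lam := by
  set d : ℕ → ℝ := fun n => f (n + 1) - f n with hd
  set w : ℕ → ℂ := fun n => (exp (I * (d n : ℂ)) - 1)⁻¹ with hw
  have hlow : ∀ n < N, lam / 2 ≤ ‖exp (I * (d n : ℂ)) - 1‖ := fun n hn => by
    have h := hf n hn
    refine le_trans ?_ (half_le_norm_exp_I_mul_sub_one (hlam.le.trans h.1) (h.2.1.trans hKl))
    linarith [h.1]
  have hne : ∀ n < N, exp (I * (d n : ℂ)) - 1 ≠ 0 := fun n hn => by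
    rw [← norm_pos_iff]
    linarith [hlow n hn]
  have hwb : ∀ n < N, ‖w n‖ ≤ 2 / lam := fun n hn => by
    rw [hw, norm_inv, ← inv_div]
    exact inv_anti₀ (by linarith) (hlow n hn)
  have hrec : ∀ n < N, exp (I * (f n : ℂ)) =
      w n * exp (I * (f (n + 1) : ℂ)) - w n * exp (I * (f n : ℂ)) := fun n hn => by
    have h1 : exp (I * (f (n + 1) : ℂ)) = exp (I * (d n : ℂ)) * exp (I * (f n : ℂ)) := by
      rw [← Complex.exp_add]
      congr 1
      simp only [hd]
      push_cast
      ring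
    have h2 : w n * (exp (I * (d n : ℂ)) - 1) = 1 := inv_mul_cancel₀ (hne n hn)
    rw [h1]
    linear_combination (-exp (I * (f n : ℂ))) * h2
  have hwdiff : ∀ n, n + 1 < N → ‖w n - w (n + 1)‖ ≤ 4 * K / (lam * L) := fun n hn => by
    have hn' : n < N := by omega
    rw [hw]
    simp only
    rw [inv_sub_inv (hne n hn') (hne _ hn), norm_div, norm_mul]
    have h1 : ‖exp (I * (d (n + 1) : ℂ)) - 1 - (exp (I * (d n : ℂ)) - 1)‖ ≤ K * lam / L := by
      rw [sub_sub_sub_cancel_right]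
      exact (norm_exp_I_mul_sub_exp_I_mul_le _ _).trans (hf n hn').2.2
    have h2 : lam / 2 * (lam / 2) ≤
        ‖exp (I * (d n : ℂ)) - 1‖ * ‖exp (I * (d (n + 1) : ℂ)) - 1‖ :=
      mul_le_mul (hlow n hn') (hlow _ hn) (by positivity) (norm_nonneg _)
    calc _ ≤ (K * lam / L) / (lam / 2 * (lam / 2)) :=
          div_le_div₀ (by positivity) h1 (by positivity) h2
      _ = 4 * K / (lam * L) := by
          field_simp
          ring
  have hind : ∀ M, M < N →
      ‖∑ n ∈ range (M + 1), exp (I * (f n : ℂ)) - w M * exp (I * (f (M + 1) : ℂ))‖ ≤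
        2 / lam + M * (4 * K / (lam * L)) := by
    intro M
    induction M with
    | zero =>
      intro h0
      rw [sum_range_one]
      have h1 : exp (I * (f 0 : ℂ)) - w 0 * exp (I * (f (0 + 1) : ℂ)) =
          -(w 0 * exp (I * (f 0 : ℂ))) := by
        linear_combination hrec 0 h0
      rw [h1, norm_neg, norm_mul, norm_exp_I_mul_real, mul_one]
      simpa using hwb 0 h0
    | succ M ih =>
      intro hM
      rw [sum_range_succ]
      have h1 : ∑ n ∈ range (M + 1), exp (I * (f n : ℂ)) + exp (I * (f (M + 1) : ℂ)) -
          w (M + 1) * exp (I * (f (M + 1 + 1) : ℂ)) =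
          (∑ n ∈ range (M + 1), exp (I * (f n : ℂ)) - w M * exp (I * (f (M + 1) : ℂ))) +
            (w M - w (M + 1)) * exp (I * (f (M + 1) : ℂ)) := by
        linear_combination hrec (M + 1) hM
      rw [h1]
      refine (norm_add_le _ _).trans ?_
      rw [norm_mul, norm_exp_I_mul_real, mul_one]
      push_cast
      linarith [ih (by omega), hwdiff M hM]
  rcases Nat.eq_zero_or_pos N with rfl | hN
  · simp only [range_zero, sum_empty, norm_zero]
    positivity
  · obtain ⟨M, rfl⟩ : ∃ M, N = M + 1 := ⟨N - 1, by omega⟩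
    have h1 := hind M (by omega)
    have h2 := hwb M (by omega)
    have h3 : ‖∑ n ∈ range (M + 1), exp (I * (f n : ℂ))‖ ≤
        ‖∑ n ∈ range (M + 1), exp (I * (f n : ℂ)) - w M * exp (I * (f (M + 1) : ℂ))‖ +
          ‖w M * exp (I * (f (M + 1) : ℂ))‖ := by
      refine le_trans (le_of_eq ?_) (norm_add_le _ _)
      rw [sub_add_cancel]
    rw [norm_mul, norm_exp_I_mul_real, mul_one] at h3
    have h4 : (M : ℝ) * (4 * K / (lam * L)) ≤ 4 * K / lam := by
      have : (M : ℝ) ≤ L := by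
        push_cast at hNL
        linarith
      calc (M : ℝ) * (4 * K / (lam * L)) ≤ L * (4 * K / (lam * L)) :=
            mul_le_mul_of_nonneg_right this (by positivity)
        _ = 4 * K / lam := by field_simp
    have h5 : (4 + 4 * K) / lam = 2 / lam + 2 / lam + 4 * K / lam := by ring
    linarith

/-! ### Differencing: induction on the order of the difference -/

theorem fwdDiff_iter_shift_sub (j h n : ℕ) (f : ℕ → ℝ) :
    (fwdDiff 1)^[j] (fun n => f (n + h) - f n) n =
      ∑ i ∈ Finset.range h, (fwdDiff 1)^[j + 1] f (n + i) := by
  have h1 : ∀ (j : ℕ) (f : ℕ → ℝ) (n : ℕ), (fwdDiff 1)^[j] (fun n => f (n + h) - f n) n =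
      (fwdDiff 1)^[j] f (n + h) - (fwdDiff 1)^[j] f n := by
    intro j
    induction j with
    | zero => intro f n; rfl
    | succ j ih =>
      intro f n
      rw [Function.iterate_succ_apply, Function.iterate_succ_apply, ← ih]
      refine congrArg (fun g : ℕ → ℝ => (fwdDiff 1)^[j] g n) (funext fun m => ?_)
      simp only [fwdDiff]
      rw [add_right_comm m 1 h]
      ring
  rw [h1]
  have h2 := Finset.sum_range_sub (fun i => (fwdDiff 1)^[j] f (n + i)) h
  rw [add_zero] at h2
  rw [← h2]
  refine Finset.sum_congr rfl fun i _ => ?_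
  rw [Function.iterate_succ_apply']
  rfl

-- Differencing by `h` replaces `f` by `f (n + h) - f n`, whose differences of order `j + 1` are
-- sums of `h` differences of `f` of order `j + 2`; the hypotheses thus pass down with `h * lam` for
-- `lam` and the same `K` and `L`. Any positive power saving is enough later, and allowing every `σ
-- ≤ (1 / 4) ^ j` lets one exponent serve several orders.
open Finset Complex in
theorem exists_norm_sum_exp_le_of_fwdDiff_iter (j : ℕ) : ∀ (K σ : ℝ), 1 ≤ K → 0 < σ →
    σ ≤ (1 / 4) ^ j → ∃ C : ℝ, 1 ≤ C ∧ ∀ (L lam : ℝ) (f : ℕ → ℝ) (N : ℕ), 1 ≤ L → 0 < lam →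
      (N : ℝ) ≤ L →
      (∀ n < N, lam ≤ (fwdDiff 1)^[j + 1] f n ∧ (fwdDiff 1)^[j + 1] f n ≤ K * lam ∧
        |(fwdDiff 1)^[j + 2] f n| ≤ K * lam / L) →
      ‖∑ n ∈ range N, exp (I * (f n : ℂ))‖ ≤ C * L * (lam ^ σ + (lam * L) ^ (-σ)) := by
  induction j with
  | zero =>
    intro K σ hK hσ hσ1
    rw [pow_zero] at hσ1
    refine ⟨4 + 4 * K, by linarith, fun L lam f N hL hlam hNL hf => ?_⟩
    have hL0 : 0 < L := by linarith
    have hlL : 0 < lam * L := by positivity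
    have p1 : 0 < lam ^ σ := Real.rpow_pos_of_pos hlam _
    have p2 : 0 < (lam * L) ^ (-σ) := Real.rpow_pos_of_pos hlL _
    have triv := (norm_sum_exp_le_card f N).trans hNL
    -- The trivial bound `N ≤ L` suffices when the claimed saving is bounded below.
    have suff : ∀ t : ℝ, 1 ≤ (4 + 4 * K) * t → t ≤ lam ^ σ + (lam * L) ^ (-σ) →
        ‖∑ n ∈ range N, exp (I * (f n : ℂ))‖ ≤
          (4 + 4 * K) * L * (lam ^ σ + (lam * L) ^ (-σ)) := by
      intro t ht ht'
      calc _ ≤ L * 1 := by linarith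
        _ ≤ L * ((4 + 4 * K) * t) := by gcongr
        _ ≤ L * ((4 + 4 * K) * (lam ^ σ + (lam * L) ^ (-σ))) := by gcongr
        _ = _ := by ring
    rcases lt_or_ge (lam * L) 1 with h | h
    · have : 1 ≤ (lam * L) ^ (-σ) := Real.one_le_rpow_of_pos_of_le_one_of_nonpos hlL h.le
        (by linarith)
      exact suff 1 (by linarith) (by linarith)
    rcases lt_or_ge 1 (K * lam) with h' | h'
    · have hK1 : K⁻¹ ≤ lam := by
        rw [inv_le_iff_one_le_mul₀ (by linarith)]
        linarith
      have h1 : (K⁻¹) ^ (1 : ℝ) ≤ (K⁻¹) ^ σ :=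
        Real.rpow_le_rpow_of_exponent_ge (by positivity) (inv_le_one_of_one_le₀ hK) hσ1
      have h2 : (K⁻¹) ^ σ ≤ lam ^ σ := Real.rpow_le_rpow (by positivity) hK1 hσ.le
      rw [Real.rpow_one] at h1
      refine suff K⁻¹ ?_ (by linarith)
      have : K * K⁻¹ = 1 := mul_inv_cancel₀ (by positivity)
      nlinarith [inv_nonneg.2 (by linarith : 0 ≤ K)]
    · have h1 := norm_sum_exp_le_of_fwdDiff_small f N K L lam hlam hK hL hNL h' hf
      have h2 : (lam * L) ^ (-1 : ℝ) ≤ (lam * L) ^ (-σ) :=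
        Real.rpow_le_rpow_of_exponent_le h (by linarith)
      rw [Real.rpow_neg_one] at h2
      calc _ ≤ (4 + 4 * K) / lam := h1
        _ = (4 + 4 * K) * L * (lam * L)⁻¹ := by field_simp
        _ ≤ (4 + 4 * K) * L * (lam ^ σ + (lam * L) ^ (-σ)) := by
          gcongr
          linarith
  | succ j ih =>
    intro K σ hK hσ hσ1
    have hσ4 : 4 * σ ≤ (1 / 4) ^ j := by
      rw [pow_succ] at hσ1
      linarith
    have hσ5 : 4 * σ ≤ 1 := hσ4.trans (pow_le_one₀ (by norm_num) (by norm_num))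
    obtain ⟨C, hC, hT⟩ := ih K (4 * σ) hK (by linarith) hσ4
    refine ⟨3 * (1 + 2 * C), by linarith, fun L lam f N hL hlam hNL hf => ?_⟩
    have hL0 : 0 < L := by linarith
    have hlL : 0 < lam * L := by positivity
    set μ := lam ^ σ with hμ
    set ν := (lam * L) ^ (-σ) with hν
    have p1 : 0 < μ := Real.rpow_pos_of_pos hlam _
    have p2 : 0 < ν := Real.rpow_pos_of_pos hlL _
    have triv := (norm_sum_exp_le_card f N).trans hNL
    have suff : 1 ≤ μ + ν → ‖∑ n ∈ range N, exp (I * (f n : ℂ))‖ ≤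
        3 * (1 + 2 * C) * L * (μ + ν) := by
      intro ht
      calc _ ≤ L * 1 := by linarith
        _ ≤ L * (μ + ν) := by gcongr
        _ ≤ (3 * (1 + 2 * C)) * (L * (μ + ν)) := le_mul_of_one_le_left (by positivity) (by linarith)
        _ = _ := by ring
    rcases lt_or_ge (lam * L) 1 with h | hlL1
    · have : 1 ≤ ν := Real.one_le_rpow_of_pos_of_le_one_of_nonpos hlL h.le (by linarith)
      exact suff (by linarith)
    rcases lt_or_ge 1 lam with h' | h'
    · have : 1 ≤ μ := Real.one_le_rpow h'.le hσ.le
      exact suff (by linarith)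
    -- With about `lam ^ (-1/2)` shifts, the diagonal contributes about `L ^ 2 * lam ^ (1/2)`, at
    -- most `L ^ 2 * μ ^ 2` since `σ ≤ 1 / 4`. Also `h * lam ≤ 2 * lam ^ (1/2)`, so exponent `4 * σ`
    -- in the induction hypothesis returns `μ ^ 2`, which the final square root turns into `μ`.
    set r := lam ^ (-(1 / 2) : ℝ) with hr
    have hr0 : 0 < r := Real.rpow_pos_of_pos hlam _
    have hr1 : 1 ≤ r := Real.one_le_rpow_of_pos_of_le_one_of_nonpos hlam h' (by norm_num)
    have hrr : lam * r = r⁻¹ := by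
      rw [hr, ← Real.rpow_neg hlam.le, mul_comm, ← Real.rpow_add_one hlam.ne']
      norm_num
    have hrL : r ≤ L := by
      have h1 : r * r = lam⁻¹ := by
        rw [hr, ← Real.rpow_add hlam, ← Real.rpow_neg_one]
        norm_num
      have h2 : lam⁻¹ ≤ L := by
        rw [inv_le_iff_one_le_mul₀ hlam]
        linarith
      nlinarith
    set H := ⌈r⌉₊ with hH
    have hH1 : r ≤ H := Nat.le_ceil r
    have hH2 : (H : ℝ) ≤ 2 * r := by
      have := Nat.ceil_lt_add_one hr0.le
      linarith
    have hHpos : (0 : ℝ) < H := by linarith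
    have hr_inv : r⁻¹ ≤ μ ^ 2 := by
      rw [hr, hμ, ← Real.rpow_neg hlam.le, ← Real.rpow_natCast, ← Real.rpow_mul hlam.le]
      refine Real.rpow_le_rpow_of_exponent_ge hlam h' ?_
      push_cast
      linarith
    have hDb : ∀ h, 1 ≤ h → h < H →
        ‖∑ n ∈ range (N - h), exp (I * (f (n + h) : ℂ)) *
          (starRingEnd ℂ) (exp (I * (f n : ℂ)))‖ ≤ C * L * (2 * μ ^ 2 + ν ^ 2) := by
      intro h hh1 hhH
      have hh1' : (1 : ℝ) ≤ h := by exact_mod_cast hh1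
      have hhH' : (h : ℝ) ≤ H := by exact_mod_cast hhH.le
      have e1 : ∑ n ∈ range (N - h), exp (I * (f (n + h) : ℂ)) *
          (starRingEnd ℂ) (exp (I * (f n : ℂ))) =
          ∑ n ∈ range (N - h), exp (I * ((f (n + h) - f n : ℝ) : ℂ)) := by
        refine sum_congr rfl fun n _ => ?_
        rw [← Complex.exp_conj, ← Complex.exp_add, map_mul, Complex.conj_I, Complex.conj_ofReal]
        congr 1
        push_cast
        ring
      rw [e1]
      have hb := hT L (h * lam) (fun n => f (n + h) - f n) (N - h) hL (by positivity)
        (le_trans (by exact_mod_cast Nat.sub_le N h) hNL) (by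
          intro n hn
          have hmem : ∀ i ∈ range h, n + i < N := fun i hi => by
            have := mem_range.1 hi
            omega
          rw [fwdDiff_iter_shift_sub, fwdDiff_iter_shift_sub]
          refine ⟨?_, ?_, ?_⟩
          · calc (h : ℝ) * lam = ∑ i ∈ range h, lam := by simp
              _ ≤ _ := sum_le_sum fun i hi => (hf _ (hmem i hi)).1
          · calc _ ≤ ∑ i ∈ range h, K * lam := sum_le_sum fun i hi => (hf _ (hmem i hi)).2.1
              _ = _ := by
                rw [sum_const, card_range, nsmul_eq_mul]
                ring
          · calc _ ≤ ∑ i ∈ range h, K * lam / L := (abs_sum_le_sum_abs _ _).trans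
                  (sum_le_sum fun i hi => (hf _ (hmem i hi)).2.2)
              _ = _ := by
                rw [sum_const, card_range, nsmul_eq_mul]
                ring)
      refine hb.trans ?_
      have hA : ((h : ℝ) * lam) ^ (4 * σ) ≤ 2 * μ ^ 2 := by
        have h1 : (h : ℝ) * lam ≤ 2 * r⁻¹ := by
          rw [← hrr]
          nlinarith
        calc ((h : ℝ) * lam) ^ (4 * σ) ≤ (2 * r⁻¹) ^ (4 * σ) :=
              Real.rpow_le_rpow (by positivity) h1 (by linarith)
          _ = 2 ^ (4 * σ) * (r⁻¹) ^ (4 * σ) := Real.mul_rpow (by norm_num) (by positivity)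
          _ ≤ 2 ^ (1 : ℝ) * μ ^ 2 := by
            refine mul_le_mul (Real.rpow_le_rpow_of_exponent_le (by norm_num) hσ5) (le_of_eq ?_)
              (by positivity) (by positivity)
            rw [hr, hμ, ← Real.rpow_neg hlam.le, ← Real.rpow_natCast, ← Real.rpow_mul hlam.le,
              ← Real.rpow_mul hlam.le]
            congr 1
            push_cast
            ring
          _ = 2 * μ ^ 2 := by rw [Real.rpow_one]
      have hB : ((h : ℝ) * lam * L) ^ (-(4 * σ)) ≤ ν ^ 2 := by
        calc ((h : ℝ) * lam * L) ^ (-(4 * σ)) ≤ (lam * L) ^ (-(4 * σ)) := by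
              refine Real.rpow_le_rpow_of_nonpos hlL ?_ (by linarith)
              rw [mul_assoc]
              exact le_mul_of_one_le_left hlL.le hh1'
          _ ≤ (lam * L) ^ (-(2 * σ)) := Real.rpow_le_rpow_of_exponent_le hlL1 (by linarith)
          _ = ν ^ 2 := by
            rw [hν, ← Real.rpow_natCast, ← Real.rpow_mul hlL.le]
            congr 1
            push_cast
            ring
      gcongr
    have hv := sq_norm_sum_le_of_shifted_correlations (fun n => exp (I * (f n : ℂ)))
      (fun n => (norm_exp_I_mul_real _).le) N H (by exact_mod_cast (by linarith : (1 : ℝ) ≤ H))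
      (C * L * (2 * μ ^ 2 + ν ^ 2)) (by positivity) hDb
    set S := ‖∑ n ∈ range N, exp (I * (f n : ℂ))‖ with hS
    have hS0 : 0 ≤ S := norm_nonneg _
    have h1 : (H : ℝ) * S ^ 2 ≤ H * (3 * L ^ 2 * (μ ^ 2 + C * (2 * μ ^ 2 + ν ^ 2))) := by
      have hinv : L ≤ H * (L * μ ^ 2) := by
        have : 1 ≤ (H : ℝ) * μ ^ 2 := by
          calc (1 : ℝ) = r * r⁻¹ := (mul_inv_cancel₀ hr0.ne').symm
            _ ≤ H * μ ^ 2 := mul_le_mul hH1 hr_inv (by positivity) hHpos.le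
        nlinarith
      calc (H : ℝ) * S ^ 2 ≤ (N + H) * (N + H * (C * L * (2 * μ ^ 2 + ν ^ 2))) := hv
        _ ≤ (3 * L) * (H * (L * μ ^ 2) + H * (C * L * (2 * μ ^ 2 + ν ^ 2))) := by
          gcongr
          · linarith
          · linarith
        _ = _ := by ring
    have h2 := le_of_mul_le_mul_left h1 hHpos
    have h3 : S ^ 2 ≤ (3 * (1 + 2 * C) * L * (μ + ν)) ^ 2 := by
      have hC3 : 3 * (1 + 2 * C) ≤ (3 * (1 + 2 * C)) ^ 2 := by nlinarith
      calc S ^ 2 ≤ _ := h2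
        _ ≤ 3 * L ^ 2 * ((1 + 2 * C) * (μ + ν) ^ 2) := by
          gcongr
          nlinarith [mul_pos p1 p2, mul_pos (mul_pos p1 p2) (by linarith : 0 < C), sq_nonneg ν,
            mul_nonneg (sq_nonneg ν) (by linarith : 0 ≤ C)]
        _ = (3 * (1 + 2 * C)) * (L * (μ + ν)) ^ 2 := by ring
        _ ≤ (3 * (1 + 2 * C)) ^ 2 * (L * (μ + ν)) ^ 2 := by gcongr
        _ = _ := by ring
    exact le_of_sq_le_sq h3 (by positivity)

/-! ### Finite differences of powers -/

theorem hasDerivAt_fwdDiff_iter (j : ℕ) : ∀ (g g' : ℝ → ℝ) (t : ℝ),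
    (∀ s, t ≤ s → HasDerivAt g (g' s) s) →
      HasDerivAt ((fwdDiff 1)^[j] g) ((fwdDiff 1)^[j] g' t) t := by
  induction j with
  | zero => exact fun g g' t h => h t le_rfl
  | succ j ih =>
    intro g g' t h
    rw [Function.iterate_succ_apply, Function.iterate_succ_apply]
    refine ih _ _ t fun s hs => ?_
    exact ((h (s + 1) (by linarith)).comp_add_const s 1).sub (h s hs)

/-- Each difference is traded for a derivative by the mean value theorem, moving the point by at
most 1. -/
theorem exists_fwdDiff_iter_rpow_eq (j : ℕ) : ∀ (β t : ℝ), 0 < t →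
    ∃ ξ, t ≤ ξ ∧ ξ ≤ t + j ∧ (fwdDiff 1)^[j] (fun s : ℝ => s ^ β) t =
      (∏ i ∈ Finset.range j, (β - i)) * ξ ^ (β - j) := by
  induction j with
  | zero => exact fun β t ht => ⟨t, le_rfl, by simp, by simp⟩
  | succ j ih =>
    intro β t ht
    have hder : ∀ u, t ≤ u → HasDerivAt ((fwdDiff 1)^[j] (fun s : ℝ => s ^ β))
        (β * (fwdDiff 1)^[j] (fun s : ℝ => s ^ (β - 1)) u) u := by
      intro u hu
      have h1 := hasDerivAt_fwdDiff_iter j (fun s : ℝ => s ^ β) (β • fun s : ℝ => s ^ (β - 1)) u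
        (fun s hs => Real.hasDerivAt_rpow_const (Or.inl (by linarith)))
      rw [fwdDiff_iter_const_smul] at h1
      exact h1
    obtain ⟨η, hη, hηeq⟩ := exists_hasDerivAt_eq_slope ((fwdDiff 1)^[j] (fun s : ℝ => s ^ β))
      (fun u => β * (fwdDiff 1)^[j] (fun s : ℝ => s ^ (β - 1)) u) (by linarith : t < t + 1)
      (fun u hu => (hder u hu.1).continuousAt.continuousWithinAt)
      (fun u hu => hder u hu.1.le)
    obtain ⟨ξ, h1, h2, h3⟩ := ih (β - 1) η (by linarith [hη.1])
    refine ⟨ξ, by linarith [hη.1], by push_cast; linarith [hη.2], ?_⟩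
    rw [Function.iterate_succ_apply', Finset.prod_range_succ']
    rw [add_sub_cancel_left, div_one] at hηeq
    change (fwdDiff 1)^[j] (fun s : ℝ => s ^ β) (t + 1) -
      (fwdDiff 1)^[j] (fun s : ℝ => s ^ β) t = _
    rw [← hηeq, h3]
    have e1 : β - 1 - (j : ℝ) = β - ((j + 1 : ℕ) : ℝ) := by push_cast; ring
    have e2 : ∏ i ∈ Finset.range j, (β - 1 - (i : ℝ)) =
        ∏ i ∈ Finset.range j, (β - ((i + 1 : ℕ) : ℝ)) :=
      Finset.prod_congr rfl fun i _ => by push_cast; ring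
    rw [e1, e2]
    push_cast
    ring

theorem fwdDiff_iter_comp_natCast (j : ℕ) : ∀ (F : ℝ → ℝ) (a n : ℕ),
    (fwdDiff 1)^[j] (fun n : ℕ => F ((a + n : ℕ) : ℝ)) n = (fwdDiff 1)^[j] F ((a + n : ℕ) : ℝ) := by
  induction j with
  | zero => exact fun F a n => rfl
  | succ j ih =>
    intro F a n
    rw [Function.iterate_succ_apply, Function.iterate_succ_apply, ← ih]
    refine congrArg (fun g : ℕ → ℝ => (fwdDiff 1)^[j] g n) (funext fun m => ?_)
    simp only [fwdDiff]
    push_cast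
    rw [add_assoc]

theorem rpow_comparable {l M ξ : ℝ} (hl : 0 < l) (hM : 1 ≤ M) (h1 : l ≤ ξ) (h2 : ξ ≤ M * l)
    (γ : ℝ) : M ^ (-|γ|) * l ^ γ ≤ ξ ^ γ ∧ ξ ^ γ ≤ M ^ |γ| * l ^ γ := by
  have hM0 : 0 < M := by linarith
  have hlγ : 0 < l ^ γ := Real.rpow_pos_of_pos hl γ
  rcases le_total 0 γ with h | h
  · rw [abs_of_nonneg h]
    constructor
    · calc M ^ (-γ) * l ^ γ ≤ 1 * l ^ γ := by
            gcongr
            exact Real.rpow_le_one_of_one_le_of_nonpos hM (by linarith)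
        _ ≤ ξ ^ γ := by
            rw [one_mul]
            exact Real.rpow_le_rpow hl.le h1 h
    · rw [← Real.mul_rpow hM0.le hl.le]
      exact Real.rpow_le_rpow (by linarith) h2 h
  · rw [abs_of_nonpos h, neg_neg]
    constructor
    · rw [← Real.mul_rpow hM0.le hl.le]
      exact Real.rpow_le_rpow_of_nonpos (by linarith) h2 h
    · calc ξ ^ γ ≤ 1 * l ^ γ := by
            rw [one_mul]
            exact Real.rpow_le_rpow_of_nonpos hl h1 h
        _ ≤ M ^ (-γ) * l ^ γ := by
            gcongr
            exact Real.one_le_rpow hM (by linarith)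

/-! ### Exponential and sine sums over a dyadic block -/

open Finset Complex in
theorem exists_norm_sum_exp_rpow_le (α : ℝ) (j : ℕ) (hj : (j : ℝ) < α) (σ : ℝ) (hσ : 0 < σ)
    (hσ1 : σ ≤ (1 / 4) ^ j) :
    ∃ C : ℝ, 0 < C ∧ ∀ (x : ℝ) (l a N : ℕ), 0 < x → 1 ≤ l → l ≤ a → a + N ≤ 2 * l →
      ‖∑ n ∈ range N, exp (I * ((((a + n : ℕ) : ℝ) ^ α * x : ℝ) : ℂ))‖ ≤
        C * l * ((x * (l : ℝ) ^ (α - (j + 1))) ^ σ + (x * (l : ℝ) ^ (α - j)) ^ (-σ)) := by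
  set p := ∏ i ∈ range (j + 1), (α - i) with hp
  set q := ∏ i ∈ range (j + 2), (α - i) with hq
  have hp0 : 0 < p := by
    refine prod_pos fun i hi => ?_
    have : (i : ℝ) ≤ j := by exact_mod_cast Nat.lt_succ_iff.1 (mem_range.1 hi)
    linarith
  set γ := α - ((j + 1 : ℕ) : ℝ) with hγ
  -- The intermediate points lie in `[l, 2l + j + 2]`, hence in `[l, M * l]` as `l ≥ 1`.
  set M : ℝ := j + 4 with hM
  have hM1 : 1 ≤ M := by
    have : (0 : ℝ) ≤ j := Nat.cast_nonneg j
    linarith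
  have hM0 : 0 < M := by linarith
  set s := p * M ^ (-|γ|) with hs
  have hs0 : 0 < s := mul_pos hp0 (Real.rpow_pos_of_pos hM0 _)
  -- The first summand is the ratio of the upper to the lower bound for the difference of order `j +
  -- 1`; the second controls order `j + 2`.
  set K := M ^ (2 * |γ|) + |q| * M ^ |γ - 1| / s with hK
  have hK2 : 0 ≤ |q| * M ^ |γ - 1| / s := by positivity
  have hK3 : 1 ≤ M ^ (2 * |γ|) := Real.one_le_rpow hM1 (by positivity)
  obtain ⟨C, hC, hT⟩ := exists_norm_sum_exp_le_of_fwdDiff_iter j K σ (by linarith) hσ hσ1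
  refine ⟨C * (s ^ σ + s ^ (-σ)), by positivity, fun x l a N hx hl hla haN => ?_⟩
  have hl1 : (1 : ℝ) ≤ l := by exact_mod_cast hl
  have hl0 : (0 : ℝ) < l := by linarith
  have hlγ : 0 < (l : ℝ) ^ γ := Real.rpow_pos_of_pos hl0 γ
  have hdiff : ∀ (k n : ℕ), (fwdDiff 1)^[k] (fun n : ℕ => ((a + n : ℕ) : ℝ) ^ α * x) n =
      x * (fwdDiff 1)^[k] (fun t : ℝ => t ^ α) ((a + n : ℕ) : ℝ) := by
    intro k n
    have h1 : (fun n : ℕ => ((a + n : ℕ) : ℝ) ^ α * x) =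
        x • fun n : ℕ => (fun t : ℝ => t ^ α) ((a + n : ℕ) : ℝ) := by
      funext m
      simp [mul_comm]
    rw [h1, fwdDiff_iter_const_smul]
    change x * _ = _
    rw [fwdDiff_iter_comp_natCast k (fun t : ℝ => t ^ α)]
  have hmain := hT l (s * (x * (l : ℝ) ^ γ)) (fun n : ℕ => ((a + n : ℕ) : ℝ) ^ α * x) N hl1
    (by positivity) (by exact_mod_cast (by omega : N ≤ l)) (by
      intro n hn
      have han1 : (l : ℝ) ≤ ((a + n : ℕ) : ℝ) := by exact_mod_cast (by omega : l ≤ a + n)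
      have han2 : ((a + n : ℕ) : ℝ) ≤ 2 * l := by exact_mod_cast (by omega : a + n ≤ 2 * l)
      have hjl : (j : ℝ) ≤ j * l := le_mul_of_one_le_right (Nat.cast_nonneg j) hl1
      rw [hdiff, hdiff]
      obtain ⟨ξ, b1, b2, b3⟩ := exists_fwdDiff_iter_rpow_eq (j + 1) α _ (hl0.trans_le han1)
      obtain ⟨η, c1, c2, c3⟩ := exists_fwdDiff_iter_rpow_eq (j + 2) α _ (hl0.trans_le han1)
      push_cast at b2 c2
      push_cast at han2
      have hξ := rpow_comparable hl0 hM1 (han1.trans b1) (by rw [hM]; linarith) γ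
      have hη := rpow_comparable hl0 hM1 (han1.trans c1) (by rw [hM]; linarith) (γ - 1)
      have e1 : α - ((j + 2 : ℕ) : ℝ) = γ - 1 := by rw [hγ]; push_cast; ring
      rw [b3, c3, e1]
      refine ⟨?_, ?_, ?_⟩
      · calc s * (x * (l : ℝ) ^ γ) = x * (p * (M ^ (-|γ|) * (l : ℝ) ^ γ)) := by rw [hs]; ring
          _ ≤ x * (p * ξ ^ γ) := by
            gcongr
            exact hξ.1
      · have hMM : M ^ |γ| = M ^ (2 * |γ|) * M ^ (-|γ|) := by
          rw [← Real.rpow_add hM0]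
          congr 1
          ring
        calc x * (p * ξ ^ γ) ≤ x * (p * (M ^ |γ| * (l : ℝ) ^ γ)) := by
              gcongr
              exact hξ.2
          _ = M ^ (2 * |γ|) * (s * (x * (l : ℝ) ^ γ)) := by rw [hMM, hs]; ring
          _ ≤ K * (s * (x * (l : ℝ) ^ γ)) := by
            gcongr
            linarith
      · have hη0 : 0 ≤ η ^ (γ - 1) := Real.rpow_nonneg (by linarith) _
        rw [abs_mul, abs_mul, abs_of_pos hx, abs_of_nonneg hη0]
        calc x * (|q| * η ^ (γ - 1)) ≤ x * (|q| * (M ^ |γ - 1| * (l : ℝ) ^ (γ - 1))) := by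
              gcongr
              exact hη.2
          _ = (|q| * M ^ |γ - 1| / s) * (s * (x * (l : ℝ) ^ γ)) / l := by
            rw [Real.rpow_sub_one hl0.ne']
            field_simp
          _ ≤ K * (s * (x * (l : ℝ) ^ γ)) / l := by
            gcongr
            linarith)
  have e2 : s * (x * (l : ℝ) ^ γ) * l = s * (x * (l : ℝ) ^ (α - j)) := by
    have : (l : ℝ) ^ (α - j) = (l : ℝ) ^ γ * l := by
      rw [← Real.rpow_add_one hl0.ne']
      congr 1
      rw [hγ]
      push_cast
      ring
    rw [this]
    ring
  have hl' : 0 < (l : ℝ) ^ (α - j) := Real.rpow_pos_of_pos hl0 _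
  rw [e2, Real.mul_rpow hs0.le (by positivity), Real.mul_rpow hs0.le (by positivity)] at hmain
  refine hmain.trans ?_
  have e3 : γ = α - (j + 1) := by rw [hγ]; push_cast; ring
  rw [← e3]
  have q1 : 0 ≤ s ^ σ := by positivity
  have q2 : 0 ≤ s ^ (-σ) := by positivity
  have q3 : 0 ≤ (x * (l : ℝ) ^ γ) ^ σ := by positivity
  have q4 : 0 ≤ (x * (l : ℝ) ^ (α - j)) ^ (-σ) := by positivity
  calc _ ≤ C * l * ((s ^ σ + s ^ (-σ)) *
        ((x * (l : ℝ) ^ γ) ^ σ + (x * (l : ℝ) ^ (α - j)) ^ (-σ))) := by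
        gcongr
        nlinarith [mul_nonneg q1 q4, mul_nonneg q2 q3]
    _ = _ := by ring

open Finset in
theorem exists_abs_sum_sin_rpow_le (α R : ℝ) (m : ℕ) (hm : 1 ≤ m) (hmα : ∀ j < m, (j : ℝ) < α)
    (hR : 0 < R) :
    ∃ C σ : ℝ, 0 < C ∧ 0 < σ ∧ ∀ (x : ℝ) (l a b : ℕ), 0 < x → x ≤ R → 1 ≤ l → l ≤ a → a ≤ b →
      b ≤ 2 * l → |∑ k ∈ Ico a b, Real.sin ((k : ℝ) ^ α * x)| ≤
        C * l * (∑ j ∈ range m, min ((x * (l : ℝ) ^ (α - j)) ^ σ) ((x * (l : ℝ) ^ (α - j)) ^ (-σ)) +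
          (R * (l : ℝ) ^ (α - m)) ^ σ) := by
  have hα : 0 < α := by simpa using hmα 0 (by omega)
  set σ : ℝ := (1 / 4) ^ m with hσ
  have hσ0 : 0 < σ := by positivity
  have hσ1 : σ ≤ 1 := pow_le_one₀ (by norm_num) (by norm_num)
  have hV : ∀ j : ℕ, ∃ C : ℝ, 0 < C ∧ (j < m → ∀ (x : ℝ) (l a N : ℕ), 0 < x → 1 ≤ l → l ≤ a →
      a + N ≤ 2 * l →
      ‖∑ n ∈ range N, Complex.exp (Complex.I * ((((a + n : ℕ) : ℝ) ^ α * x : ℝ) : ℂ))‖ ≤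
        C * l * ((x * (l : ℝ) ^ (α - (j + 1))) ^ σ + (x * (l : ℝ) ^ (α - j)) ^ (-σ))) := by
    intro j
    by_cases hj : j < m
    · obtain ⟨C, hC, h⟩ := exists_norm_sum_exp_rpow_le α j (hmα j hj) σ hσ0
        (pow_le_pow_of_le_one (by norm_num) (by norm_num) hj.le)
      exact ⟨C, hC, fun _ => h⟩
    · exact ⟨1, one_pos, fun h => absurd h hj⟩
  choose D hD0 hD using hV
  set C := 2 ^ α + 2 * ∑ j ∈ range m, D j with hC
  have hDs : 0 ≤ ∑ j ∈ range m, D j := sum_nonneg fun j _ => (hD0 j).le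
  have h2α : (0 : ℝ) < 2 ^ α := Real.rpow_pos_of_pos two_pos α
  refine ⟨C, σ, by positivity, hσ0, fun x l a b hx hxR hl hla hab hbl => ?_⟩
  have hl1 : (1 : ℝ) ≤ l := by exact_mod_cast hl
  have hl0 : (0 : ℝ) < l := by linarith
  set y : ℕ → ℝ := fun j => x * (l : ℝ) ^ (α - j) with hy
  have hy0 : ∀ j, 0 < y j := fun j => mul_pos hx (Real.rpow_pos_of_pos hl0 _)
  set G := ∑ j ∈ range m, min (y j ^ σ) (y j ^ (-σ)) with hG
  have hGj : ∀ j < m, min (y j ^ σ) (y j ^ (-σ)) ≤ G := fun j hj =>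
    single_le_sum (f := fun j => min (y j ^ σ) (y j ^ (-σ)))
      (fun i _ => le_min (Real.rpow_nonneg (hy0 i).le _) (Real.rpow_nonneg (hy0 i).le _))
      (mem_range.2 hj)
  have hG1 : ∀ j < m, y j ≤ 1 → y j ^ σ ≤ G := fun j hj h => by
    refine le_trans (le_of_eq (min_eq_left ?_).symm) (hGj j hj)
    exact Real.rpow_le_rpow_of_exponent_ge (hy0 j) h (by linarith)
  have hG2 : ∀ j < m, 1 ≤ y j → y j ^ (-σ) ≤ G := fun j hj h => by
    refine le_trans (le_of_eq (min_eq_right ?_).symm) (hGj j hj)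
    exact Real.rpow_le_rpow_of_exponent_le h (by linarith)
  set E := (R * (l : ℝ) ^ (α - m)) ^ σ with hE
  have hE0 : 0 ≤ E := by positivity
  have hG0 : 0 ≤ G := sum_nonneg fun i _ =>
    le_min (Real.rpow_nonneg (hy0 i).le _) (Real.rpow_nonneg (hy0 i).le _)
  change _ ≤ C * l * (G + E)
  have hexp : ∀ j < m, |∑ k ∈ Ico a b, Real.sin ((k : ℝ) ^ α * x)| ≤
      D j * l * (y (j + 1) ^ σ + y j ^ (-σ)) := by
    intro j hj
    have h1 := hD j hj x l a (b - a) hx hl hla (by omega)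
    have h2 : ∑ k ∈ Ico a b, Real.sin ((k : ℝ) ^ α * x) = (∑ n ∈ range (b - a),
        Complex.exp (Complex.I * ((((a + n : ℕ) : ℝ) ^ α * x : ℝ) : ℂ))).im := by
      rw [sum_Ico_eq_sum_range, Complex.im_sum]
      refine sum_congr rfl fun n _ => ?_
      rw [mul_comm Complex.I, Complex.exp_ofReal_mul_I_im]
    rw [h2]
    refine (Complex.abs_im_le_norm _).trans (h1.trans (le_of_eq ?_))
    simp only [hy]
    push_cast
    rfl
  have hDC : ∀ j < m, ∀ t, 0 ≤ t → t ≤ 2 * (G + E) → D j * l * t ≤ C * l * (G + E) := by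
    intro j hj t ht0 ht
    have h1 : D j ≤ ∑ j ∈ range m, D j :=
      single_le_sum (fun i _ => (hD0 i).le) (mem_range.2 hj)
    calc D j * l * t ≤ D j * l * (2 * (G + E)) := by
          have := (hD0 j).le
          gcongr
      _ = (2 * D j) * l * (G + E) := by ring
      _ ≤ C * l * (G + E) := by
          gcongr
          linarith
  have hsum0 : ∀ j, 0 ≤ y (j + 1) ^ σ + y j ^ (-σ) := fun j =>
    add_nonneg (Real.rpow_nonneg (hy0 _).le _) (Real.rpow_nonneg (hy0 _).le _)
  rcases lt_or_ge (y 0) 1 with h0 | h0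
  -- The whole phase is at most `2 ^ α * y 0`, so `|sin u| ≤ |u|` suffices.
  · have hyσ : y 0 ≤ G := by
      refine le_trans ?_ (hG1 0 (by omega) h0.le)
      calc y 0 = y 0 ^ (1 : ℝ) := (Real.rpow_one _).symm
        _ ≤ y 0 ^ σ := Real.rpow_le_rpow_of_exponent_ge (hy0 0) h0.le hσ1
    have hb : ((b - a : ℕ) : ℝ) ≤ l := by exact_mod_cast (by omega : b - a ≤ l)
    calc |∑ k ∈ Ico a b, Real.sin ((k : ℝ) ^ α * x)| ≤ ∑ k ∈ Ico a b, 2 ^ α * y 0 := by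
          refine (abs_sum_le_sum_abs _ _).trans (sum_le_sum fun k hk => ?_)
          have hk2 : (k : ℝ) ≤ 2 * l := by
            have := (mem_Ico.1 hk).2
            exact_mod_cast (by omega : k ≤ 2 * l)
          have hk0 : 0 ≤ (k : ℝ) ^ α * x := by positivity
          refine Real.abs_sin_le_abs.trans ?_
          rw [abs_of_nonneg hk0]
          calc (k : ℝ) ^ α * x ≤ (2 * l) ^ α * x := by gcongr
            _ = 2 ^ α * y 0 := by
              rw [Real.mul_rpow (by norm_num) hl0.le]
              simp only [hy, Nat.cast_zero, sub_zero]
              ring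
      _ = ((b - a : ℕ) : ℝ) * (2 ^ α * y 0) := by
          rw [sum_const, Nat.card_Ico, nsmul_eq_mul]
      _ ≤ l * (2 ^ α * (G + E)) := by
          have := hy0 0
          gcongr
          linarith
      _ = 2 ^ α * l * (G + E) := by ring
      _ ≤ C * l * (G + E) := by
          gcongr
          linarith
  by_cases hex : ∃ j, j < m ∧ y j < 1
  · classical
    -- The first index with `y < 1` is some `i + 1`, so `y (i + 1) < 1 ≤ y i` and both terms of the
    -- bound of order `i` are minima counted in `G`.
    obtain ⟨h1, h2⟩ := Nat.find_spec hex
    have hmin := fun j => Nat.find_min (H := hex) (m := j)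
    obtain ⟨i, hi⟩ : ∃ i, Nat.find hex = i + 1 := by
      refine Nat.exists_eq_succ_of_ne_zero fun h => ?_
      rw [h] at h2
      linarith
    rw [hi] at h1 h2 hmin
    have h3 : 1 ≤ y i := by
      by_contra hlt
      exact hmin i (by omega) ⟨by omega, not_le.1 hlt⟩
    refine (hexp i (by omega)).trans (hDC i (by omega) _ (hsum0 i) ?_)
    linarith [hG1 (i + 1) h1 h2.le, hG2 i (by omega) h3]
  · have hall : ∀ j < m, 1 ≤ y j := fun j hj => not_lt.1 fun h => hex ⟨j, hj, h⟩
    obtain ⟨i, rfl⟩ : ∃ i, m = i + 1 := Nat.exists_eq_succ_of_ne_zero (by omega)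
    refine (hexp i (by omega)).trans (hDC i (by omega) _ (hsum0 i) ?_)
    have h1 : y (i + 1) ^ σ ≤ E := by
      refine Real.rpow_le_rpow (hy0 _).le ?_ hσ0.le
      exact mul_le_mul_of_nonneg_right hxR (Real.rpow_nonneg hl0.le _)
    linarith [hG2 i (by omega) (hall i (by omega))]

/-! ### Summation over dyadic scales -/

theorem sum_min_geometric_inv_le {ρ t : ℝ} (hρ : 1 < ρ) (ht : 0 < t) (n : ℕ) :
    ∑ i ∈ Finset.range n, min (t * ρ ^ i) (t * ρ ^ i)⁻¹ ≤ 2 * (1 + ρ) / (ρ - 1) := by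
  set K := 2 * (1 + ρ) / (ρ - 1) with hK
  have hρ1 : 0 < ρ - 1 := by linarith
  have hK0 : 0 < K := by positivity
  -- `min u u⁻¹` is dominated by the increment of the bounded function `K * u / (1 + u)` from `u` to
  -- `ρ * u`, so the geometric sum telescopes, with a bound independent of `t`.
  have key : ∀ u : ℝ, 0 < u → min u u⁻¹ ≤ K * (ρ * u / (1 + ρ * u)) - K * (u / (1 + u)) := by
    intro u hu
    have h1 : K * (ρ * u / (1 + ρ * u)) - K * (u / (1 + u)) =
        2 * (1 + ρ) * u / ((1 + ρ * u) * (1 + u)) := by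
      rw [hK]
      field_simp
      ring
    rw [h1]
    rcases le_total u 1 with h | h
    · refine (min_le_left _ _).trans ?_
      rw [le_div_iff₀ (by positivity)]
      have : (1 + ρ * u) * (1 + u) ≤ (1 + ρ) * 2 := by
        have : ρ * u ≤ ρ := mul_le_of_le_one_right (by linarith) h
        gcongr
        linarith
      nlinarith
    · refine (min_le_right _ _).trans ?_
      rw [inv_eq_one_div, div_le_div_iff₀ hu (by positivity)]
      have : (1 + ρ * u) * (1 + u) ≤ ((1 + ρ) * u) * (2 * u) := by
        gcongr
        · linarith
        · linarith
      linarith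
  calc _ ≤ ∑ i ∈ Finset.range n, (K * (t * ρ ^ (i + 1) / (1 + t * ρ ^ (i + 1))) -
        K * (t * ρ ^ i / (1 + t * ρ ^ i))) := by
        refine Finset.sum_le_sum fun i _ => ?_
        have h := key (t * ρ ^ i) (by positivity)
        have e : ρ * (t * ρ ^ i) = t * ρ ^ (i + 1) := by ring
        rwa [e] at h
    _ = K * (t * ρ ^ n / (1 + t * ρ ^ n)) - K * (t * ρ ^ 0 / (1 + t * ρ ^ 0)) :=
        Finset.sum_range_sub (fun i => K * (t * ρ ^ i / (1 + t * ρ ^ i))) n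
    _ ≤ K * 1 - 0 := by
        refine sub_le_sub ?_ (by positivity)
        gcongr
        rw [div_le_one (by positivity)]
        linarith
    _ = K := by ring

theorem rpow_two_pow_mul (x β σ : ℝ) (hx : 0 < x) (i : ℕ) :
    (x * (((2 ^ i : ℕ) : ℝ)) ^ β) ^ σ = x ^ σ * ((2 : ℝ) ^ (β * σ)) ^ i := by
  have h : (0 : ℝ) < ((2 ^ i : ℕ) : ℝ) := by positivity
  rw [Real.mul_rpow hx.le (Real.rpow_nonneg h.le _), ← Real.rpow_mul h.le]
  push_cast
  rw [← Real.rpow_natCast, ← Real.rpow_natCast, ← Real.rpow_mul (by norm_num),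
    ← Real.rpow_mul (by norm_num), mul_comm (i : ℝ)]

open Finset in
theorem exists_dyadic_sum_le (α R σ : ℝ) (m : ℕ) (hmα : ∀ j < m, (j : ℝ) < α) (hαm : α < m)
    (hR : 0 < R) (hσ : 0 < σ) :
    ∃ T : ℝ, 0 < T ∧ ∀ (x : ℝ) (n : ℕ), 0 < x →
      ∑ i ∈ range n, (∑ j ∈ range m, min ((x * ((2 ^ i : ℕ) : ℝ) ^ (α - j)) ^ σ)
        ((x * ((2 ^ i : ℕ) : ℝ) ^ (α - j)) ^ (-σ)) +
          (R * ((2 ^ i : ℕ) : ℝ) ^ (α - m)) ^ σ) ≤ T := by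
  set ρ : ℕ → ℝ := fun j => 2 ^ ((α - j) * σ) with hρ
  have hρ1 : ∀ j < m, 1 < ρ j := fun j hj =>
    Real.one_lt_rpow (by norm_num) (mul_pos (by linarith [hmα j hj]) hσ)
  have hρm : ρ m < 1 :=
    Real.rpow_lt_one_of_one_lt_of_neg (by norm_num) (mul_neg_of_neg_of_pos (by linarith) hσ)
  have hρm0 : 0 < ρ m := Real.rpow_pos_of_pos two_pos _
  have hs : 0 ≤ ∑ j ∈ range m, 2 * (1 + ρ j) / (ρ j - 1) := sum_nonneg fun j hj => by
    have := hρ1 j (mem_range.1 hj)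
    have h' : 0 < ρ j - 1 := by linarith
    positivity
  have h1m : 0 < 1 - ρ m := by linarith
  refine ⟨∑ j ∈ range m, 2 * (1 + ρ j) / (ρ j - 1) + R ^ σ * (1 - ρ m)⁻¹, by positivity,
    fun x n hx => ?_⟩
  rw [sum_add_distrib, sum_comm]
  refine add_le_add (sum_le_sum fun j hj => ?_) ?_
  · refine le_trans (le_of_eq ?_)
      (sum_min_geometric_inv_le (hρ1 j (mem_range.1 hj)) (Real.rpow_pos_of_pos hx σ) n)
    refine sum_congr rfl fun i _ => ?_
    rw [Real.rpow_neg (by positivity), rpow_two_pow_mul x _ σ hx]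
  · calc _ = R ^ σ * ∑ i ∈ range n, ρ m ^ i := by
          rw [mul_sum]
          exact sum_congr rfl fun i _ => rpow_two_pow_mul R _ σ hR i
      _ ≤ R ^ σ * (1 - ρ m)⁻¹ := by
          gcongr
          rw [← tsum_geometric_of_lt_one hρm0.le hρm]
          exact (summable_geometric_of_lt_one hρm0.le hρm).sum_le_tsum _
            fun i _ => by positivity

/-! ### Abel summation and the uniform tail bound -/

theorem nonneg_of_isGeneralMonotone {c : ℕ → ℝ} (hgm : IsGeneralMonotone c) {l : ℕ} (hl : 1 ≤ l) :
    0 ≤ c l := by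
  obtain ⟨B, hB, h⟩ := hgm
  exact nonneg_of_mul_nonneg_right ((Finset.sum_nonneg fun _ _ => abs_nonneg _).trans (h l hl)) hB

open Finset in
theorem abs_sum_mul_le_of_abs_sum_le (c s : ℕ → ℝ) (a b : ℕ) (hab : a ≤ b) (P : ℝ)
    (hP : ∀ t, a ≤ t → t ≤ b → |∑ k ∈ Ico a t, s k| ≤ P) :
    |∑ k ∈ Ico a b, c k * s k| ≤ (|c b| + ∑ k ∈ Ico a b, |c k - c (k + 1)|) * P := by
  have hsum : ∑ k ∈ Ico a b, c k * s k = c b * ∑ k ∈ Ico a b, s k +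
      ∑ k ∈ Ico a b, (c k - c (k + 1)) * ∑ i ∈ Ico a (k + 1), s i := by
    clear hP
    induction b, hab using Nat.le_induction with
    | base => simp
    | succ b hab ih =>
      rw [sum_Ico_succ_top hab, ih, sum_Ico_succ_top hab s,
        sum_Ico_succ_top hab (fun k => (c k - c (k + 1)) * ∑ i ∈ Ico a (k + 1), s i),
        sum_Ico_succ_top hab s]
      ring
  rw [hsum, add_mul, sum_mul]
  refine (abs_add_le _ _).trans (add_le_add ?_ ?_)
  · rw [abs_mul]
    exact mul_le_mul_of_nonneg_left (hP b hab le_rfl) (abs_nonneg _)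
  · refine (abs_sum_le_sum_abs _ _).trans (sum_le_sum fun k hk => ?_)
    obtain ⟨h1, h2⟩ := mem_Ico.1 hk
    rw [abs_mul]
    exact mul_le_mul_of_nonneg_left (hP _ (by omega) (by omega)) (abs_nonneg _)

-- The block bound is assumed for all subintervals, so an incomplete first or last block needs no
-- special treatment.
open Finset in
theorem abs_sum_Ico_le_sum_dyadic (F β : ℕ → ℝ) (hβ : ∀ n, 0 ≤ β n) (N₀ : ℕ) (hN₀ : 1 ≤ N₀)
    (hF : ∀ n a b : ℕ, N₀ ≤ a → 2 ^ n ≤ a → a ≤ b → b ≤ 2 ^ (n + 1) →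
      |∑ k ∈ Ico a b, F k| ≤ β n) (n : ℕ) :
    ∀ N M : ℕ, N₀ ≤ N → M ≤ 2 ^ n → |∑ k ∈ Ico N M, F k| ≤ ∑ i ∈ range n, β i := by
  induction n with
  | zero =>
    intro N M hN hM
    rw [Ico_eq_empty_of_le (by rw [pow_zero] at hM; omega)]
    simp
  | succ n ih =>
    intro N M hN hM
    rw [sum_range_succ]
    rcases le_total M (2 ^ n) with h | h
    · linarith [ih N M hN h, hβ n]
    rcases le_total M N with h' | h'
    · rw [Ico_eq_empty_of_le h', sum_empty, abs_zero]
      exact add_nonneg (sum_nonneg fun i _ => hβ i) (hβ n)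
    rcases le_total N (2 ^ n) with h2 | h2
    · rw [← sum_Ico_consecutive _ h2 h]
      exact (abs_add_le _ _).trans (add_le_add (ih N _ hN le_rfl)
        (hF n _ M (hN.trans h2) le_rfl h hM))
    · have := hF n N M hN h2 h' hM
      linarith [sum_nonneg (s := range n) (fun i _ => hβ i)]

open Finset in
theorem sinePartialSum_sub (α : ℝ) (c : ℕ → ℝ) {m n : ℕ} (h : m ≤ n) (x : ℝ) :
    sinePartialSum α c n x - sinePartialSum α c m x =
      ∑ k ∈ Ico (m + 1) (n + 1), c k * Real.sin ((k : ℝ) ^ α * x) := by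
  have hI : ∀ N : ℕ, Icc 1 N = Ico 1 (N + 1) := fun N => by
    ext k
    simp only [mem_Icc, mem_Ico]
    omega
  rw [sinePartialSum, sinePartialSum, hI, hI, sub_eq_iff_eq_add',
    sum_Ico_consecutive _ (by omega) (by omega)]

theorem abs_sum_mul_sin_eq_abs (α : ℝ) (c : ℕ → ℝ) (s : Finset ℕ) (x : ℝ) :
    |∑ k ∈ s, c k * Real.sin ((k : ℝ) ^ α * x)| =
      |∑ k ∈ s, c k * Real.sin ((k : ℝ) ^ α * |x|)| := by
  rcases le_total 0 x with h | h
  · rw [abs_of_nonneg h]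
  · rw [abs_of_nonpos h, ← abs_neg, ← Finset.sum_neg_distrib]
    refine congrArg _ (Finset.sum_congr rfl fun k _ => ?_)
    rw [mul_neg, Real.sin_neg, mul_neg]

open Finset in
theorem exists_abs_tail_le (α : ℝ) (hα : 0 < α) (hαint : ∀ m : ℤ, α ≠ (m : ℝ))
    (c : ℕ → ℝ) (hc : IsQuasiNonincreasing c) (hgm : IsGeneralMonotone c) (R : ℝ) (hR : 0 < R) :
    ∃ T : ℝ, 0 < T ∧ ∀ (ε : ℝ) (N₀ : ℕ), 0 < ε → 1 ≤ N₀ → (∀ k, N₀ ≤ k → c k * k ≤ ε) →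
      ∀ (x : ℝ) (N M : ℕ), |x| ≤ R → N₀ ≤ N →
        |∑ k ∈ Ico N M, c k * Real.sin ((k : ℝ) ^ α * x)| ≤ T * ε := by
  have hnn := fun l (hl : 1 ≤ l) => nonneg_of_isGeneralMonotone hgm hl
  obtain ⟨A, hA, hcA⟩ := hc
  obtain ⟨B, hB, hcB⟩ := hgm
  set m := ⌈α⌉₊ with hm
  have hmα : ∀ j < m, (j : ℝ) < α := fun j hj => Nat.lt_ceil.1 hj
  -- Strict because `α` is not an integer; this makes the last term of the block bound summable.
  have hαm : α < m := lt_of_le_of_ne (Nat.le_ceil α) (by exact_mod_cast hαint m)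
  obtain ⟨C, σ, hC, hσ, hblock⟩ := exists_abs_sum_sin_rpow_le α R m (Nat.ceil_pos.2 hα) hmα hR
  obtain ⟨T, hT, hdy⟩ := exists_dyadic_sum_le α R σ m hmα hαm hR hσ
  refine ⟨(A + B) * C * T, by positivity, fun ε N₀ hε hN₀ hck x N M hx hN => ?_⟩
  rw [abs_sum_mul_sin_eq_abs]
  rcases eq_or_lt_of_le (abs_nonneg x) with h0 | h0
  · rw [← h0]
    simp only [mul_zero, Real.sin_zero, sum_const_zero, abs_zero]
    positivity
  set z := |x| with hz
  set G : ℕ → ℝ := fun i => ∑ j ∈ range m, min ((z * ((2 ^ i : ℕ) : ℝ) ^ (α - j)) ^ σ)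
        ((z * ((2 ^ i : ℕ) : ℝ) ^ (α - j)) ^ (-σ)) + (R * ((2 ^ i : ℕ) : ℝ) ^ (α - m)) ^ σ with hG
  have hG0 : ∀ i, 0 ≤ G i := fun i => by
    refine add_nonneg (sum_nonneg fun j _ => le_min ?_ ?_) ?_ <;> positivity
  have hF : ∀ n a b : ℕ, N₀ ≤ a → 2 ^ n ≤ a → a ≤ b → b ≤ 2 ^ (n + 1) →
      |∑ k ∈ Ico a b, c k * Real.sin ((k : ℝ) ^ α * z)| ≤ (A + B) * C * ε * G n := by
    intro n a b ha hna hab hbn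
    have hbn' : b ≤ 2 * 2 ^ n := by rw [pow_succ] at hbn; omega
    have ha1 : 1 ≤ a := hN₀.trans ha
    have h1 := abs_sum_mul_le_of_abs_sum_le c (fun k => Real.sin ((k : ℝ) ^ α * z)) a b hab
      (C * ((2 ^ n : ℕ) : ℝ) * G n) (fun t hat htb => hblock z (2 ^ n) a t h0 hx
        Nat.one_le_two_pow hna hat (htb.trans hbn'))
    have h2 : |c b| ≤ A * c a := by
      rw [abs_of_nonneg (hnn b (ha1.trans hab))]
      exact hcA a b ha1 hab
    have h3 : ∑ k ∈ Ico a b, |c k - c (k + 1)| ≤ B * c a := by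
      refine le_trans (sum_le_sum_of_subset_of_nonneg ?_ fun _ _ _ => abs_nonneg _) (hcB a ha1)
      exact Ico_subset_Ico_right (by omega)
    have h4 : c a * ((2 ^ n : ℕ) : ℝ) ≤ ε := by
      refine le_trans ?_ (hck a ha)
      exact mul_le_mul_of_nonneg_left (by exact_mod_cast hna) (hnn a ha1)
    have hGn := hG0 n
    calc _ ≤ _ := h1
      _ ≤ (A * c a + B * c a) * (C * ((2 ^ n : ℕ) : ℝ) * G n) := by gcongr
      _ = (A + B) * C * (c a * ((2 ^ n : ℕ) : ℝ)) * G n := by ring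
      _ ≤ (A + B) * C * ε * G n := by gcongr
  -- `M` blocks are enough because `M < 2 ^ M`; the dyadic bound does not depend on their number.
  have h5 := abs_sum_Ico_le_sum_dyadic (fun k => c k * Real.sin ((k : ℝ) ^ α * z))
    (fun n => (A + B) * C * ε * G n) (fun n => mul_nonneg (by positivity) (hG0 n)) N₀ hN₀ hF M N M
    hN Nat.lt_two_pow_self.le
  refine h5.trans ?_
  rw [← mul_sum]
  calc (A + B) * C * ε * ∑ i ∈ range M, G i ≤ (A + B) * C * ε * T := by
        gcongr
        exact hdy z M h0
    _ = _ := by ring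

/-! ### Sufficiency and necessity -/

theorem exists_tendstoUniformlyOn_of_uniformCauchySeqOn {F : ℕ → ℝ → ℝ} {S : Set ℝ}
    (h : UniformCauchySeqOn F Filter.atTop S) :
    ∃ f : ℝ → ℝ, TendstoUniformlyOn F f Filter.atTop S := by
  have hlim : ∀ x, ∃ y, x ∈ S → Filter.Tendsto (fun n => F n x) Filter.atTop (nhds y) := by
    intro x
    by_cases hx : x ∈ S
    · obtain ⟨y, hy⟩ := cauchySeq_tendsto_of_complete (h.cauchySeq hx)
      exact ⟨y, fun _ => hy⟩
    · exact ⟨0, fun hx' => absurd hx' hx⟩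
  choose f hf using hlim
  exact ⟨f, h.tendstoUniformlyOn_of_tendsto fun x hx => hf x hx⟩

theorem sineSeriesConvergesUniformlyOn_of_tendsto (α : ℝ) (hα : 0 < α)
    (hαint : ∀ m : ℤ, α ≠ (m : ℝ)) (c : ℕ → ℝ) (hc : IsQuasiNonincreasing c)
    (hgm : IsGeneralMonotone c)
    (h : Filter.Tendsto (fun k : ℕ => c k * (k : ℝ)) Filter.atTop (nhds 0))
    (S : Set ℝ) (hS : Bornology.IsBounded S) : SineSeriesConvergesUniformlyOn α c S := by
  obtain ⟨R, hR, hSR⟩ := hS.exists_pos_norm_le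
  obtain ⟨T, hT, htail⟩ := exists_abs_tail_le α hα hαint c hc hgm R hR
  apply exists_tendstoUniformlyOn_of_uniformCauchySeqOn
  rw [Metric.uniformCauchySeqOn_iff]
  intro ε hε
  obtain ⟨N₀, hN₀⟩ := Filter.eventually_atTop.1
    (h.eventually (ge_mem_nhds (by positivity : 0 < ε / (2 * T))))
  have key : ∀ m n, N₀ ≤ m → m ≤ n → ∀ x ∈ S,
      |sinePartialSum α c n x - sinePartialSum α c m x| < ε := by
    intro m n hm hmn x hx
    rw [sinePartialSum_sub α c hmn]
    refine lt_of_le_of_lt (htail (ε / (2 * T)) (N₀ + 1) (by positivity) (by omega)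
      (fun k hk => hN₀ k (by omega)) x (m + 1) (n + 1) (hSR x hx) (by omega)) ?_
    have : T * (ε / (2 * T)) = ε / 2 := by field_simp
    linarith
  refine ⟨N₀, fun m hm n hn x hx => ?_⟩
  rw [Real.dist_eq]
  rcases le_total m n with hmn | hmn
  · rw [abs_sub_comm]
    exact key m n hm hmn x hx
  · exact key n m hn hmn x hx

open Finset in
theorem tendsto_of_sineSeriesConvergesUniformlyOn (α : ℝ) (hα : 0 < α) (c : ℕ → ℝ)
    (hc : IsQuasiNonincreasing c) (hgm : IsGeneralMonotone c)
    (h : SineSeriesConvergesUniformlyOn α c (Set.Icc 0 2)) :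
    Filter.Tendsto (fun k : ℕ => c k * (k : ℝ)) Filter.atTop (nhds 0) := by
  have hnn := fun l (hl : 1 ≤ l) => nonneg_of_isGeneralMonotone hgm hl
  obtain ⟨A, hA, hcA⟩ := hc
  obtain ⟨f, hf⟩ := h
  have hcau := Metric.uniformCauchySeqOn_iff.1 hf.uniformCauchySeqOn
  have h2α : (0 : ℝ) < 2 ^ (-α) := Real.rpow_pos_of_pos two_pos _
  rw [Metric.tendsto_atTop]
  intro ε hε
  -- One factor `A` pays for `c i ≥ c (2n) / A`, the other for `c k ≤ A * c (2n)`; the 3 comes from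
  -- `k ≤ 3n`, where `n = k / 2` is rounded down.
  obtain ⟨N, hN⟩ := hcau (2 ^ (-α) * ε / (3 * A ^ 2)) (by positivity)
  refine ⟨2 * N + 2, fun k hk => ?_⟩
  set n := k / 2 with hn
  have hn1 : 1 ≤ n := by omega
  have hn0 : (1 : ℝ) ≤ n := by exact_mod_cast hn1
  -- This puts the phases for `n < i ≤ 2n` in `[2 ^ (-α) * π / 2, π / 2]`, where Jordan's inequality
  -- gives `sin ≥ 2 ^ (-α)`.
  set x : ℝ := Real.pi / 2 * (2 * n : ℝ) ^ (-α) with hx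
  have hpi := Real.pi_pos
  have hpi4 := Real.pi_le_four
  have hxS : x ∈ Set.Icc (0 : ℝ) 2 := by
    refine ⟨by positivity, ?_⟩
    have : (2 * n : ℝ) ^ (-α) ≤ 1 :=
      Real.rpow_le_one_of_one_le_of_nonpos (by linarith) (by linarith)
    calc x ≤ Real.pi / 2 * 1 := by
          rw [hx]
          gcongr
      _ ≤ 2 := by linarith
  have h1 := hN (2 * n) (by omega) n (by omega) x hxS
  rw [Real.dist_eq, sinePartialSum_sub α c (by omega)] at h1
  have hc2n : 0 ≤ c (2 * n) := hnn _ (by omega)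
  have hlow : (n : ℝ) * (c (2 * n) / A * 2 ^ (-α)) ≤
      ∑ i ∈ Ico (n + 1) (2 * n + 1), c i * Real.sin ((i : ℝ) ^ α * x) := by
    have hcard : ((Ico (n + 1) (2 * n + 1)).card : ℝ) = n := by
      rw [Nat.card_Ico]
      congr 1
      omega
    rw [← hcard, ← nsmul_eq_mul, ← sum_const]
    refine sum_le_sum fun i hi => ?_
    obtain ⟨hi1, hi2⟩ := mem_Ico.1 hi
    have hi1' : (n : ℝ) ≤ i := by exact_mod_cast (by omega : n ≤ i)
    have hi2' : (i : ℝ) ≤ 2 * n := by exact_mod_cast (by omega : i ≤ 2 * n)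
    have hci : c (2 * n) / A ≤ c i := by
      rw [div_le_iff₀ hA, mul_comm (c i)]
      exact hcA i (2 * n) (by omega) (by omega)
    have hinv : (2 * n : ℝ) ^ α * (2 * n : ℝ) ^ (-α) = 1 := by
      rw [← Real.rpow_add (by positivity), add_neg_cancel, Real.rpow_zero]
    have hθ0 : 0 ≤ (i : ℝ) ^ α * x := by positivity
    have hθ1 : (i : ℝ) ^ α * x ≤ Real.pi / 2 := by
      calc (i : ℝ) ^ α * x ≤ (2 * n : ℝ) ^ α * x := by gcongr
        _ = Real.pi / 2 * ((2 * n : ℝ) ^ α * (2 * n : ℝ) ^ (-α)) := by rw [hx]; ring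
        _ = Real.pi / 2 := by rw [hinv, mul_one]
    have hθ2 : 2 ^ (-α) * (Real.pi / 2) ≤ (i : ℝ) ^ α * x := by
      have hnα : (n : ℝ) ^ α * (n : ℝ) ^ (-α) = 1 := by
        rw [← Real.rpow_add (by positivity), add_neg_cancel, Real.rpow_zero]
      calc 2 ^ (-α) * (Real.pi / 2) =
            2 ^ (-α) * (Real.pi / 2) * ((n : ℝ) ^ α * (n : ℝ) ^ (-α)) := by rw [hnα, mul_one]
        _ = (n : ℝ) ^ α * x := by
          rw [hx, Real.mul_rpow (by norm_num) (by positivity)]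
          ring
        _ ≤ (i : ℝ) ^ α * x := by gcongr
    have hsin : 2 ^ (-α) ≤ Real.sin ((i : ℝ) ^ α * x) := by
      refine le_trans ?_ (Real.mul_le_sin hθ0 hθ1)
      calc (2 : ℝ) ^ (-α) = 2 / Real.pi * (2 ^ (-α) * (Real.pi / 2)) := by field_simp
        _ ≤ _ := by gcongr
    exact mul_le_mul hci hsin h2α.le (hnn i (by omega))
  have h2 : (n : ℝ) * (c (2 * n) / A * 2 ^ (-α)) < 2 ^ (-α) * ε / (3 * A ^ 2) :=
    lt_of_le_of_lt (hlow.trans (le_abs_self _)) h1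
  have h3 : 3 * A * (n * c (2 * n)) < ε := by
    have e1 : (n : ℝ) * (c (2 * n) / A * 2 ^ (-α)) =
        2 ^ (-α) * (3 * A * (n * c (2 * n))) / (3 * A ^ 2) := by field_simp
    rw [e1, div_lt_div_iff_of_pos_right (by positivity)] at h2
    exact lt_of_mul_lt_mul_left h2 h2α.le
  have hck : 0 ≤ c k := hnn k (by omega)
  rw [Real.dist_eq, sub_zero, abs_of_nonneg (by positivity)]
  have hk3 : (k : ℝ) ≤ 3 * n := by exact_mod_cast (by omega : k ≤ 3 * n)
  calc c k * k ≤ (A * c (2 * n)) * (3 * n) := by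
        have := hcA (2 * n) k (by omega) (by omega)
        gcongr
    _ = 3 * A * (n * c (2 * n)) := by ring
    _ < ε := h3

theorem theorem1p2 (α : ℝ) (hα : 0 < α) (hαint : ∀ m : ℤ, α ≠ (m : ℝ))
    (c : ℕ → ℝ) (hc : IsQuasiNonincreasing c) (hgm : IsGeneralMonotone c) :
    (∀ S : Set ℝ, Bornology.IsBounded S → SineSeriesConvergesUniformlyOn α c S) ↔
      Filter.Tendsto (fun k : ℕ => c k * (k : ℝ)) Filter.atTop (nhds 0) :=
  ⟨fun h => tendsto_of_sineSeriesConvergesUniformlyOn α hα c hc hgm (h _ (Metric.isBounded_Icc 0 2)),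
    fun h S hS => sineSeriesConvergesUniformlyOn_of_tendsto α hα hαint c hc hgm h S hS⟩
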